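/- Let $\varepsilon_0,\varepsilon_1\in\{1,-1\}$ and let $M$ be a smooth (Hausdorff) manifold of dimension $2n+1$ with an almost (para)contact metric structure $(\varphi,\xi,\eta,g)$, that is, a smooth $(1,1)$-tensor field $\varphi$, a smooth vector field $\xi$, a smooth $1$-form $\eta$ and a Riemannian or pseudo-Riemannian metric $g$ such that, for all vector fields $X,Y$, $$\varphi^2X=\varepsilon_1(X-\eta(X)\xi),\qquad \eta(\xi)=1,\qquad g(\varphi X,\varphi Y)=-\varepsilon_1\bigl(g(X,Y)-\varepsilon_0\,\eta(X)\eta(Y)\bigr).$$ Suppose that the structure is normal, that is, for all $X,Y\in\mathfrak X(M)$, $$\varphi^2[X,Y]+[\varphi X,\varphi Y]-\varphi[\varphi X,Y]-\varphi[X,\varphi Y]-2\varepsilon_1\,d\eta(X,Y)\,\xi=0,$$ where $d\eta(X,Y)=\tfrac12\bigl(X(\eta(Y))-Y(\eta(X))-\eta([X,Y])\bigr)$. Let $\nabla$ be the Levi-Civita connection of $g$, let $R(X,Y)=[\nabla_X,\nabla_Y]-\nabla_{[X,Y]}$ be its curvature operator, and write $[A,B]=A\circ B-B\circ A$ for operators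 $A,B$ on vector fields. Then, for all $X,Y,Z\in\mathfrak X(M)$, $$\bigl([R(Z,\varphi X),\varphi]+[R(\varphi Z,X),\varphi]+\varepsilon_1[R(\varphi Z,\varphi X),\varphi]\varphi+[R(Z,X),\varphi]\varphi\bigr)Y=-\eta(Y)\bigl(\varepsilon_1R(Z,X)\xi+R(\varphi Z,\varphi X)\xi\bigr)$$ and $$\begin{aligned}&\varepsilon_1R(Z,X)Y-\varphi R(Z,X)\varphi Y+R(Z,\varphi X)\varphi Y-\varphi R(Z,\varphi X)Y\\&\quad+R(\varphi Z,X)\varphi Y-\varphi R(\varphi Z,X)Y+R(\varphi Z,\varphi X)Y-\varepsilon_1\varphi R(\varphi Z,\varphi X)\varphi Y=0.\end{aligned}$$ -/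

import Mathlib

open Bundle Manifold VectorField
open scoped ContDiff

noncomputable section

namespace ParaContact

variable {d : ℕ} {M : Type*} [TopologicalSpace M] [ChartedSpace (EuclideanSpace ℝ (Fin d)) M]

/-- (Not necessarily smooth) vector fields on the `d`-dimensional manifold `M`. -/
abbrev VField (d : ℕ) (M : Type*) [TopologicalSpace M]
    [ChartedSpace (EuclideanSpace ℝ (Fin d)) M] : Type _ :=
  (x : M) → TangentSpace (𝓡 d) x

/-- `X ∈ 𝔛(M)`: the vector field `X` is smooth. -/
def IsSmoothVF [IsManifold (𝓡 d) ∞ M] (X : VField d M) : Prop :=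
  ContMDiff (𝓡 d) ((𝓡 d).prod 𝓘(ℝ, EuclideanSpace ℝ (Fin d))) ∞
    (fun x ↦ TotalSpace.mk' (EuclideanSpace ℝ (Fin d)) (E := TangentSpace (𝓡 d)) x (X x))

variable (d M) in
/-- A smooth `(1,1)`-tensor field, as a smooth section of `End(TM)`. -/
structure EndoField [IsManifold (𝓡 d) ∞ M] where
  toFun : (x : M) → TangentSpace (𝓡 d) x →L[ℝ] TangentSpace (𝓡 d) x
  smooth : ContMDiff (𝓡 d)
    ((𝓡 d).prod 𝓘(ℝ, EuclideanSpace ℝ (Fin d) →L[ℝ] EuclideanSpace ℝ (Fin d))) ∞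
    (fun x ↦ TotalSpace.mk' (EuclideanSpace ℝ (Fin d) →L[ℝ] EuclideanSpace ℝ (Fin d))
      (E := fun x : M ↦ TangentSpace (𝓡 d) x →L[ℝ] TangentSpace (𝓡 d) x) x (toFun x))

/-- The operator `X ↦ φX` on vector fields; it is also written as the application `φ X`. -/
def EndoField.onVF [IsManifold (𝓡 d) ∞ M] (φ : EndoField d M) (X : VField d M) : VField d M :=
  fun x ↦ φ.toFun x (X x)

instance [IsManifold (𝓡 d) ∞ M] : CoeFun (EndoField d M) (fun _ ↦ VField d M → VField d M) :=
  ⟨EndoField.onVF⟩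

variable (d M) in
/-- A smooth `1`-form, as a smooth section of `T*M`. -/
structure OneForm [IsManifold (𝓡 d) ∞ M] where
  toFun : (x : M) → TangentSpace (𝓡 d) x →L[ℝ] ℝ
  smooth : ContMDiff (𝓡 d) ((𝓡 d).prod 𝓘(ℝ, EuclideanSpace ℝ (Fin d) →L[ℝ] ℝ)) ∞
    (fun x ↦ TotalSpace.mk' (EuclideanSpace ℝ (Fin d) →L[ℝ] ℝ)
      (E := fun x : M ↦ TangentSpace (𝓡 d) x →L[ℝ] ℝ) x (toFun x))

/-- The function `η(X)`; it is also written as the application `η X`. -/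
def OneForm.onVF [IsManifold (𝓡 d) ∞ M] (η : OneForm d M) (X : VField d M) : M → ℝ :=
  fun x ↦ η.toFun x (X x)

instance [IsManifold (𝓡 d) ∞ M] : CoeFun (OneForm d M) (fun _ ↦ VField d M → M → ℝ) :=
  ⟨OneForm.onVF⟩

/-- The exterior derivative
`dη(X, Y) = ½ (X(η(Y)) - Y(η(X)) - η([X, Y]))`. -/
def OneForm.extDeriv [IsManifold (𝓡 d) ∞ M] (η : OneForm d M) (X Y : VField d M) : M → ℝ :=
  fun x ↦ (1 / 2 : ℝ) * (mvfderiv (𝓡 d) (η Y) x (X x) - mvfderiv (𝓡 d) (η X) x (Y x)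
    - η (mlieBracket (𝓡 d) X Y) x)

variable (d M) in
/-- A smooth pseudo-Riemannian (possibly Riemannian) metric. -/
structure PseudoRiemannianMetric [IsManifold (𝓡 d) ∞ M] where
  toFun : (x : M) → TangentSpace (𝓡 d) x →L[ℝ] TangentSpace (𝓡 d) x →L[ℝ] ℝ
  smooth : ContMDiff (𝓡 d) ((𝓡 d).prod
      𝓘(ℝ, EuclideanSpace ℝ (Fin d) →L[ℝ] EuclideanSpace ℝ (Fin d) →L[ℝ] ℝ)) ∞
    (fun x ↦ TotalSpace.mk' (EuclideanSpace ℝ (Fin d) →L[ℝ] EuclideanSpace ℝ (Fin d) →L[ℝ] ℝ)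
      (E := fun x : M ↦ TangentSpace (𝓡 d) x →L[ℝ] TangentSpace (𝓡 d) x →L[ℝ] ℝ) x (toFun x))
  symm : ∀ x (v w : TangentSpace (𝓡 d) x), toFun x v w = toFun x w v
  nondegenerate : ∀ x (v : TangentSpace (𝓡 d) x), (∀ w, toFun x v w = 0) → v = 0

/-- The function `g(X, Y)`. -/
def PseudoRiemannianMetric.onVF [IsManifold (𝓡 d) ∞ M] (g : PseudoRiemannianMetric d M)
    (X Y : VField d M) : M → ℝ :=
  fun x ↦ g.toFun x (X x) (Y x)

variable (d M) in
/-- The type of affine connections: covariant derivatives on the tangent bundle. In Mathlib's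
argument order, `D Y x (X x)` is the value of `∇_X Y` at `x`. -/
abbrev AffineConnection [IsManifold (𝓡 d) ∞ M] : Type _ :=
  CovariantDerivative (𝓡 d) (EuclideanSpace ℝ (Fin d)) (TangentSpace (𝓡 d) : M → Type _)

/-- The vector field `∇_X Y`. -/
def nabla [IsManifold (𝓡 d) ∞ M] (D : AffineConnection d M) (X Y : VField d M) : VField d M :=
  fun x ↦ D Y x (X x)

/-- `D` is the Levi-Civita connection of `g`: a smooth affine connection, torsion-free and
compatible with the metric, `X g(Y, Z) = g(∇_X Y, Z) + g(Y, ∇_X Z)`. -/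
structure IsLeviCivita [IsManifold (𝓡 d) ∞ M] (g : PseudoRiemannianMetric d M)
    (D : AffineConnection d M) : Prop where
  smooth : D.ContMDiffCovariantDerivative ∞
  torsion_free : D.torsion = 0
  metric : ∀ X Y Z : VField d M, IsSmoothVF X → IsSmoothVF Y → IsSmoothVF Z → ∀ x,
    mvfderiv (𝓡 d) (g.onVF Y Z) x (X x) = g.onVF (nabla D X Y) Z x + g.onVF Y (nabla D X Z) x

/-- The curvature operator `R(X, Y) = [∇_X, ∇_Y] - ∇_{[X, Y]}` on vector fields. -/
def curvature [IsManifold (𝓡 d) ∞ M] (D : AffineConnection d M) (X Y : VField d M) :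
    VField d M → VField d M :=
  fun Z ↦ nabla D X (nabla D Y Z) - nabla D Y (nabla D X Z) - nabla D (mlieBracket (𝓡 d) X Y) Z

/-- The opCommutator `[A, B] = A ∘ B - B ∘ A` of operators on vector fields. -/
def opCommutator (A B : VField d M → VField d M) : VField d M → VField d M :=
  fun X ↦ A (B X) - B (A X)

variable (d M) in
/-- An almost (para)contact metric structure `(φ, ξ, η, g)` with signs `ε₀`, `ε₁`. -/
structure AlmostParaContactMetric [IsManifold (𝓡 d) ∞ M] (ε₀ ε₁ : ℝ) where
  φ : EndoField d M
  ξ : VField d M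
  η : OneForm d M
  g : PseudoRiemannianMetric d M
  smooth_ξ : IsSmoothVF ξ
  ε₀_sign : ε₀ = 1 ∨ ε₀ = -1
  ε₁_sign : ε₁ = 1 ∨ ε₁ = -1
  φ_sq : ∀ x (v : TangentSpace (𝓡 d) x),
    φ.toFun x (φ.toFun x v) = ε₁ • (v - η.toFun x v • ξ x)
  η_ξ : ∀ x, η.toFun x (ξ x) = 1
  compatible : ∀ x (v w : TangentSpace (𝓡 d) x),
    g.toFun x (φ.toFun x v) (φ.toFun x w)
      = -ε₁ * (g.toFun x v w - ε₀ * (η.toFun x v * η.toFun x w))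

namespace AlmostParaContactMetric

variable [IsManifold (𝓡 d) ∞ M] {ε₀ ε₁ : ℝ}

/-- The Nijenhuis tensor `N(X, Y) = φ²[X, Y] + [φX, φY] - φ[φX, Y] - φ[X, φY]` of `φ`. -/
def nijenhuis (S : AlmostParaContactMetric d M ε₀ ε₁) (X Y : VField d M) : VField d M :=
  S.φ (S.φ (mlieBracket (𝓡 d) X Y)) + mlieBracket (𝓡 d) (S.φ X) (S.φ Y)
    - S.φ (mlieBracket (𝓡 d) (S.φ X) Y) - S.φ (mlieBracket (𝓡 d) X (S.φ Y))

/-- The tensor field `N⁽¹⁾(X, Y) = N(X, Y) - 2 ε₁ dη(X, Y) ξ`. -/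
def nijenhuisOne (S : AlmostParaContactMetric d M ε₀ ε₁) (X Y : VField d M) : VField d M :=
  fun x ↦ S.nijenhuis X Y x - (2 * ε₁ * S.η.extDeriv X Y x) • S.ξ x

/-- The structure is normal if `N⁽¹⁾` vanishes identically. -/
def IsNormal (S : AlmostParaContactMetric d M ε₀ ε₁) : Prop :=
  ∀ X Y : VField d M, IsSmoothVF X → IsSmoothVF Y → ∀ x, S.nijenhuisOne X Y x = 0

end AlmostParaContactMetric

end ParaContact

end

open Bundle Manifold VectorField
open scoped ContDiff

noncomputable section

namespace ParaContact

/-! ### Smooth vector fields and derivations. -/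

variable {d : ℕ} {M : Type*} [TopologicalSpace M] [ChartedSpace (EuclideanSpace ℝ (Fin d)) M]
  [IsManifold (𝓡 d) ∞ M]

/-! For the Levi-Civita connection, normality is equivalent to a first-order relation, (∇_{φX}φ)Y -
φ(∇_Xφ)Y = ε₁(∇_Xη)(Y)ξ; only the implication from normality is needed. The difference of the two
sides is symmetric in X, Y by normality and zero torsion, and its pairing with Z is skew in Y, Z by
metricity; such a trilinear expression vanishes (`normalDefect_eq_zero`).

Let p = φ and q = η ⊗ ξ act on smooth fields. Since η(∇_Xξ) = 0, the relation for a = ∇_X and a' =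
∇_{φX} reads a'p - pa' + ε₁a - pap = ε₁qaq (`nablaEnd_φ_relation`). The second curvature identity is
then noncommutative algebra. Applied to products of covariant derivatives, its left side collapses
to products of compressions such as qaq (`normal_pair_mul`); applied to the derivatives along
brackets, it collapses to compressions of those (`normal_pair_bracket`, using normality again). A
compression q∇_Xq only differentiates the coefficient of ξ along X, so [Z,X]f = Z(Xf) - X(Zf) makes
everything cancel.

The first identity follows from the second by expanding φ²Y, since R is tensorial in its last
argument. -/

theorem IsSmoothVF.mdifferentiableAt {X : VField d M} (hX : IsSmoothVF X) (x : M) :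
    MDifferentiableAt (𝓡 d) ((𝓡 d).prod 𝓘(ℝ, EuclideanSpace ℝ (Fin d)))
      (fun x ↦ TotalSpace.mk' (EuclideanSpace ℝ (Fin d)) (E := TangentSpace (𝓡 d)) x (X x)) x :=
  ContMDiff.mdifferentiableAt hX (by simp)

theorem IsSmoothVF.smul {f : M → ℝ} (hf : ContMDiff (𝓡 d) 𝓘(ℝ) ∞ f) {X : VField d M}
    (hX : IsSmoothVF X) : IsSmoothVF (f • X) :=
  ContMDiff.smul_section hf hX

variable (d M) in
/-- The real vector space of smooth vector fields. -/
def SmoothVF : Submodule ℝ (VField d M) where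
  carrier := {X | IsSmoothVF X}
  add_mem' hX hY := ContMDiff.add_section hX hY
  zero_mem' := contMDiff_zeroSection ℝ _
  smul_mem' c _ hX := ContMDiff.const_smul_section (a := c) hX

theorem EndoField.isSmoothVF (φ : EndoField d M) {X : VField d M} (hX : IsSmoothVF X) :
    IsSmoothVF (φ X) :=
  ContMDiff.clm_bundle_apply φ.smooth hX

theorem OneForm.contMDiff (η : OneForm d M) {X : VField d M} (hX : IsSmoothVF X) :
    ContMDiff (𝓡 d) 𝓘(ℝ) ∞ (η X) := by
  intro x
  have h := (η.smooth x).clm_bundle_apply (F₂ := ℝ) (E₂ := Bundle.Trivial M ℝ) (hX x)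
  rw [contMDiffAt_section] at h
  exact h

theorem PseudoRiemannianMetric.contMDiff (g : PseudoRiemannianMetric d M) {X Y : VField d M}
    (hX : IsSmoothVF X) (hY : IsSmoothVF Y) : ContMDiff (𝓡 d) 𝓘(ℝ) ∞ (g.onVF X Y) := by
  intro x
  have h := (g.smooth x).clm_bundle_apply₂ (F₃ := ℝ) (E₃ := Bundle.Trivial M ℝ) (hX x) (hY x)
  rw [contMDiffAt_section] at h
  exact h

instance : IsManifold (𝓡 d) (minSmoothness ℝ 2) M := by
  rw [minSmoothness_of_isRCLikeNormedField]; infer_instance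

instance : IsManifold (𝓡 d) (minSmoothness ℝ 3) M := by
  rw [minSmoothness_of_isRCLikeNormedField]
  infer_instance

theorem isSmoothVF_mlieBracket {X Y : VField d M} (hX : IsSmoothVF X) (hY : IsSmoothVF Y) :
    IsSmoothVF (mlieBracket (𝓡 d) X Y) := by
  have : IsManifold (𝓡 d) (((⊤ : ℕ∞) : WithTop ℕ∞) + 1) M := ‹IsManifold (𝓡 d) ∞ M›
  exact fun x ↦ ContMDiffAt.mlieBracket_vectorField (m := ⊤) (n := ⊤) (hX x) (hY x)
    (by rw [minSmoothness_of_isRCLikeNormedField]; rfl)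

theorem isSmoothVF_nabla {D : AffineConnection d M} (hD : D.ContMDiffCovariantDerivative ∞)
    {X Y : VField d M} (hX : IsSmoothVF X) (hY : IsSmoothVF Y) : IsSmoothVF (nabla D X Y) := by
  have h := hD.contMDiff.contMDiff (σ := Y) (ContMDiff.contMDiffOn hY)
  rw [contMDiffOn_univ] at h
  exact ContMDiff.clm_bundle_apply h hX

/-- The derivative `X f` of a function along a smooth vector field. -/
theorem contMDiff_mvfderiv {f : M → ℝ} (hf : ContMDiff (𝓡 d) 𝓘(ℝ) ∞ f) {X : VField d M}
    (hX : IsSmoothVF X) : ContMDiff (𝓡 d) 𝓘(ℝ) ∞ (fun x ↦ mvfderiv (𝓡 d) f x (X x)) := by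
  -- The function X f is the fibre component of the tangent map of f composed with X.
  have h := (hf.contMDiff_tangentMap (m := ∞) (by simp)).comp hX
  intro x
  have h2 := h x
  rw [contMDiffAt_totalSpace] at h2
  simpa [mvfderiv] using! h2.2

/-- A local extension is cut off by a bump function; this lets nondegeneracy of g be tested on
smooth fields. -/
theorem exists_isSmoothVF_eq [T2Space M] (x : M) (v : TangentSpace (𝓡 d) x) :
    ∃ X : VField d M, IsSmoothVF X ∧ X x = v := by
  obtain ⟨s, hs, h⟩ := FiberBundle.exists_contMDiffOn_extend (𝓡 d) (EuclideanSpace ℝ (Fin d))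
    (V := TangentSpace (𝓡 d)) (k := ∞) v
  obtain ⟨f, -, hf⟩ := (SmoothBumpFunction.nhds_basis_tsupport (I := 𝓡 d) x).mem_iff.1
    (interior_mem_nhds.2 hs)
  refine ⟨(f : M → ℝ) • FiberBundle.extend (EuclideanSpace ℝ (Fin d)) v, fun y ↦ ?_, by simp⟩
  by_cases hy : y ∈ tsupport f
  · exact f.contMDiffAt.smul_section
      ((h y (interior_subset (hf hy))).contMDiffAt (mem_interior_iff_mem_nhds.1 (hf hy)))
  · refine (contMDiff_zeroSection (n := ∞) (IB := 𝓡 d) ℝ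
      (TangentSpace (𝓡 d) : M → Type _) y).congr_of_eventuallyEq ?_
    filter_upwards [(isClosed_tsupport f).isOpen_compl.mem_nhds hy] with z hz
    simp [image_eq_zero_of_notMem_tsupport hz, zeroSection]

/-- `[V, W] f = V (W f) - W (V f)`, tested on a vector field that does not vanish at `x`. -/
theorem mvfderiv_mlieBracket {f : M → ℝ} (hf : ContMDiff (𝓡 d) 𝓘(ℝ) ∞ f) {V W U : VField d M}
    (hV : IsSmoothVF V) (hW : IsSmoothVF W) (hU : IsSmoothVF U) {x : M} (hx : U x ≠ 0) :
    mvfderiv (𝓡 d) f x (mlieBracket (𝓡 d) V W x)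
      = mvfderiv (𝓡 d) (fun y ↦ mvfderiv (𝓡 d) f y (W y)) x (V x)
        - mvfderiv (𝓡 d) (fun y ↦ mvfderiv (𝓡 d) f y (V y)) x (W x) := by
  have hd (g : M → ℝ) (hg : ContMDiff (𝓡 d) 𝓘(ℝ) ∞ g) (y : M) :
      MDifferentiableAt (𝓡 d) 𝓘(ℝ) g y := hg.mdifferentiableAt (by simp)
  have le2 : minSmoothness ℝ 2 ≤ (∞ : WithTop ℕ∞) := by
    rw [minSmoothness_of_isRCLikeNormedField]; exact ENat.LEInfty.out
  have jac (Y : VField d M) (hY : IsSmoothVF Y) :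
      mlieBracket (𝓡 d) V (mlieBracket (𝓡 d) W Y) x
        = mlieBracket (𝓡 d) (mlieBracket (𝓡 d) V W) Y x
          + mlieBracket (𝓡 d) W (mlieBracket (𝓡 d) V Y) x :=
    leibniz_identity_mlieBracket_apply ((hV x).of_le le2) ((hW x).of_le le2) ((hY x).of_le le2)
  have leib (V : VField d M) (g : M → ℝ) (hg : ContMDiff (𝓡 d) 𝓘(ℝ) ∞ g) (Y : VField d M)
      (hY : IsSmoothVF Y) : mlieBracket (𝓡 d) V (g • Y)
        = (fun y ↦ mvfderiv (𝓡 d) g y (V y)) • Y + g • mlieBracket (𝓡 d) V Y := by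
    funext y
    exact mlieBracket_smul_right (hd g hg y) (hY.mdifferentiableAt y)
  have add (V Y Y' : VField d M) (hY : IsSmoothVF Y) (hY' : IsSmoothVF Y') :
      mlieBracket (𝓡 d) V (Y + Y') = mlieBracket (𝓡 d) V Y + mlieBracket (𝓡 d) V Y' := by
    funext y
    exact mlieBracket_add_right (hY.mdifferentiableAt y) (hY'.mdifferentiableAt y)
  have hVf := contMDiff_mvfderiv hf hV
  have hWf := contMDiff_mvfderiv hf hW
  have hVU := isSmoothVF_mlieBracket hV hU
  have hWU := isSmoothVF_mlieBracket hW hU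
  -- The Jacobi identity for f U, expanded by the Leibniz rule, differs from f times the one for U
  -- by the wanted identity multiplied by U.
  have key := jac (f • U) (hU.smul hf)
  rw [leib W f hf U hU, leib V f hf U hU, leib _ f hf U hU, add _ _ _ (hU.smul hWf) (hWU.smul hf),
    add _ _ _ (hU.smul hVf) (hVU.smul hf), leib _ _ hWf U hU, leib _ _ hVf U hU,
    leib _ f hf _ hWU, leib _ f hf _ hVU] at key
  simp only [Pi.add_apply, Pi.smul_apply', jac U hU] at key
  rw [← sub_eq_zero]
  refine (smul_eq_zero.1 ?_).resolve_right hx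
  rw [← sub_eq_zero] at key
  rw [← neg_eq_zero, ← key]
  module

/-! ### Pointwise algebra of the structure. -/

namespace AlmostParaContactMetric
variable {ε₀ ε₁ : ℝ} (S : AlmostParaContactMetric d M ε₀ ε₁)
include S

theorem ε₁_mul_self : ε₁ * ε₁ = 1 := by
  rcases S.ε₁_sign with h | h <;> simp [h]

theorem ξ_ne_zero (x : M) : S.ξ x ≠ 0 := by
  intro h
  simpa [h] using S.η_ξ x

theorem φ_ξ (x : M) : S.φ.toFun x (S.ξ x) = 0 := by
  have e := S.ε₁_mul_self
  have h0 : S.φ.toFun x (S.φ.toFun x (S.ξ x)) = 0 := by simp [S.φ_sq, S.η_ξ]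
  have h1 := S.φ_sq x (S.φ.toFun x (S.ξ x))
  rw [h0, map_zero] at h1
  have h2 : S.φ.toFun x (S.ξ x) = S.η.toFun x (S.φ.toFun x (S.ξ x)) • S.ξ x := by
    have := congrArg (ε₁ • ·) h1
    simp only [smul_zero, smul_smul, e, one_smul] at this
    exact sub_eq_zero.1 this.symm
  generalize S.η.toFun x (S.φ.toFun x (S.ξ x)) = c at h2
  -- With φξ = cξ, the equation φ²ξ = 0 gives c² = 0.
  rw [h2, map_smul, h2, smul_smul] at h0
  rw [h2, mul_self_eq_zero.1 ((smul_eq_zero.1 h0).resolve_right (S.ξ_ne_zero x)), zero_smul]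

/-- Computing φ³v as φ²(φv) and as φ(φ²v) leaves a multiple of ξ that must vanish. -/
theorem η_φ (x : M) (v : TangentSpace (𝓡 d) x) : S.η.toFun x (S.φ.toFun x v) = 0 := by
  have h := S.φ_sq x (S.φ.toFun x v)
  rw [S.φ_sq x v, map_smul, map_sub, map_smul, S.φ_ξ, smul_zero, sub_zero] at h
  have := congrArg (ε₁ • ·) h
  simp only [smul_smul, S.ε₁_mul_self, one_smul] at this
  refine (smul_eq_zero.1 (?_ : _ • S.ξ x = 0)).resolve_right (S.ξ_ne_zero x)
  exact (sub_eq_self.1 this.symm)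

theorem g_ξ (x : M) (v : TangentSpace (𝓡 d) x) : S.g.toFun x v (S.ξ x) = ε₀ * S.η.toFun x v := by
  have h := S.compatible x v (S.ξ x)
  rw [S.φ_ξ, map_zero, S.η_ξ] at h
  have e := S.ε₁_mul_self
  linear_combination ε₁ * h - (S.g.toFun x v (S.ξ x) - ε₀ * S.η.toFun x v) * e

theorem g_φ_left (x : M) (v w : TangentSpace (𝓡 d) x) :
    S.g.toFun x (S.φ.toFun x v) w = -S.g.toFun x v (S.φ.toFun x w) := by
  have h := S.compatible x (S.φ.toFun x v) w
  have h' := S.g_ξ x (S.φ.toFun x w)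
  have e := S.ε₁_mul_self
  rw [S.g.symm] at h'
  rw [S.φ_sq, S.η_φ] at h
  simp only [map_smul, map_sub, smul_apply, sub_apply,
    smul_eq_mul, h', S.η_φ] at h
  linear_combination ε₁ * h
    - (S.g.toFun x (S.φ.toFun x v) w + S.g.toFun x v (S.φ.toFun x w)) * e

end AlmostParaContactMetric

/-! ### Normality as a first-order relation between ∇ and φ. -/

theorem IsLeviCivita.sub_eq_mlieBracket {g : PseudoRiemannianMetric d M} {D : AffineConnection d M}
    (hD : IsLeviCivita g D) {X Y : VField d M} (hX : IsSmoothVF X) (hY : IsSmoothVF Y) (x : M) :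
    mlieBracket (𝓡 d) X Y x = D Y x (X x) - D X x (Y x) :=
  (D.torsion_eq_zero_iff.1 hD.torsion_free (hX.mdifferentiableAt x) (hY.mdifferentiableAt x)).symm

namespace AlmostParaContactMetric
variable {ε₀ ε₁ : ℝ} (S : AlmostParaContactMetric d M ε₀ ε₁)

/-- The tensor field
`(∇_{φX} φ)Y - φ(∇_X φ)Y - ε₁ (∇_X η)(Y) ξ`, whose vanishing characterizes normality. -/
def normalDefect (D : AffineConnection d M) (X Y : VField d M) : VField d M := fun x ↦
  D (S.φ Y) x (S.φ X x) - S.φ.toFun x (D Y x (S.φ X x)) - S.φ.toFun x (D (S.φ Y) x (X x))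
    + ε₁ • D Y x (X x) - (ε₁ * mvfderiv (𝓡 d) (S.η Y) x (X x)) • S.ξ x

variable {S} {D : AffineConnection d M}

/-- Once brackets are written through ∇, the antisymmetrization of the defect is exactly the tensor
that normality kills. -/
theorem normalDefect_comm (hS : S.IsNormal) (hD : IsLeviCivita S.g D) {X Y : VField d M}
    (hX : IsSmoothVF X) (hY : IsSmoothVF Y) (x : M) :
    S.normalDefect D X Y x = S.normalDefect D Y X x := by
  have h := hS X Y hX hY x
  have hφX := S.φ.isSmoothVF hX
  have hφY := S.φ.isSmoothVF hY
  simp only [nijenhuisOne, nijenhuis, Pi.sub_apply, Pi.add_apply, EndoField.onVF, S.φ_sq] at h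
  have e1 := hD.sub_eq_mlieBracket hX hY x
  have e2 := hD.sub_eq_mlieBracket hφX hφY x
  have e3 := hD.sub_eq_mlieBracket hφX hY x
  have e4 := hD.sub_eq_mlieBracket hX hφY x
  simp only [EndoField.onVF] at e2 e3 e4
  simp only [OneForm.extDeriv, OneForm.onVF, e1, e2, e3, e4, map_sub] at h
  rw [← sub_eq_zero, ← h]
  simp only [normalDefect, EndoField.onVF]
  module

/-- Metricity is used for four pairs: the derivatives along φX cancel because φ is g-skew, and those
along X are linked by the compatibility of g with φ. -/
theorem normalDefect_skew (hD : IsLeviCivita S.g D) {X Y Z : VField d M}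
    (hX : IsSmoothVF X) (hY : IsSmoothVF Y) (hZ : IsSmoothVF Z) (x : M) :
    S.g.toFun x (S.normalDefect D X Y x) (Z x) = -S.g.toFun x (S.normalDefect D X Z x) (Y x) := by
  have hφX := S.φ.isSmoothVF hX
  have hφY := S.φ.isSmoothVF hY
  have hφZ := S.φ.isSmoothVF hZ
  have hd {f : M → ℝ} (hf : ContMDiff (𝓡 d) 𝓘(ℝ) ∞ f) :
      MDifferentiableAt (𝓡 d) 𝓘(ℝ) f x := hf.mdifferentiableAt (by simp)
  have hηY := hd (S.η.contMDiff hY)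
  have hηZ := hd (S.η.contMDiff hZ)
  have m1 := hD.metric _ _ _ hφX hφY hZ x
  have m2 := hD.metric _ _ _ hφX hφZ hY x
  have m3 := hD.metric _ _ _ hX hφY hφZ x
  have m4 := hD.metric _ _ _ hX hY hZ x
  have f1 : S.g.onVF (S.φ Y) Z = -S.g.onVF (S.φ Z) Y := by
    funext y
    exact (S.g_φ_left y _ _).trans (by rw [S.g.symm]; rfl)
  have f3 : S.g.onVF (S.φ Y) (S.φ Z)
      = (-ε₁) • (S.g.onVF Y Z - ε₀ • (S.η Y * S.η Z)) := by
    funext y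
    exact S.compatible y _ _
  have d3 : mvfderiv (𝓡 d) (S.g.onVF (S.φ Y) (S.φ Z)) x (X x)
      = -ε₁ * (mvfderiv (𝓡 d) (S.g.onVF Y Z) x (X x)
        - ε₀ * (S.η Y x * mvfderiv (𝓡 d) (S.η Z) x (X x)
          + S.η Z x * mvfderiv (𝓡 d) (S.η Y) x (X x))) := by
    have hc (c : ℝ) : MDifferentiableAt (𝓡 d) 𝓘(ℝ) (fun _ : M ↦ c) x :=
      mdifferentiableAt_const
    have hsm (c : ℝ) (f : M → ℝ) (hf : MDifferentiableAt (𝓡 d) 𝓘(ℝ) f x) :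
        mvfderiv (𝓡 d) (c • f) x = c • mvfderiv (𝓡 d) f x := by
      have := mvfderiv_smul (hc c) hf
      rw [mvfderiv_const] at this
      simpa using! this
    have hm : MDifferentiableAt (𝓡 d) 𝓘(ℝ) (ε₀ • (S.η Y * S.η Z)) x :=
      (hc ε₀).smul (hηY.mul hηZ)
    rw [f3, hsm, mvfderiv_sub, hsm, mvfderiv_mul hηY hηZ]
    · rfl
    · exact hηY.mul hηZ
    · exact hd (S.g.contMDiff hY hZ)
    · exact hm
    · exact (hd (S.g.contMDiff hY hZ)).sub hm
  rw [f1, mvfderiv_neg, neg_apply] at m1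
  rw [d3] at m3
  simp only [PseudoRiemannianMetric.onVF, nabla, EndoField.onVF] at m1 m2 m3 m4
  rw [S.g.symm x (Y x)] at m4
  rw [S.g.symm x (S.φ.toFun x (Y x))] at m3 m1
  rw [S.g.symm x (S.φ.toFun x (Z x))] at m2
  simp only [normalDefect, EndoField.onVF, map_sub, map_add, map_smul, smul_apply, sub_apply,
    add_apply, smul_eq_mul, S.g_φ_left, S.g.symm x (S.ξ x), S.g_ξ]
  simp only [OneForm.onVF] at m3 ⊢
  linear_combination -m1 - m2 - m3 - ε₁ * m4

theorem normalDefect_eq_zero [T2Space M] (hS : S.IsNormal) (hD : IsLeviCivita S.g D)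
    {X Y : VField d M} (hX : IsSmoothVF X) (hY : IsSmoothVF Y) (x : M) :
    S.normalDefect D X Y x = 0 := by
  refine S.g.nondegenerate x _ fun w ↦ ?_
  obtain ⟨Z, hZ, rfl⟩ := exists_isSmoothVF_eq x w
  have h1 := normalDefect_skew hD hX hY hZ x
  -- Alternating three swaps of each kind returns to the starting term with the opposite sign.
  rw [normalDefect_comm hS hD hX hZ, normalDefect_skew hD hZ hX hY,
    normalDefect_comm hS hD hZ hY, normalDefect_skew hD hY hZ hX,
    normalDefect_comm hS hD hY hX] at h1
  linarith

/-- The function g(ξ, ξ) = ε₀ is constant. -/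
theorem η_nabla_ξ (hD : IsLeviCivita S.g D) {X : VField d M} (hX : IsSmoothVF X) (x : M) :
    S.η.toFun x (D S.ξ x (X x)) = 0 := by
  have m := hD.metric X S.ξ S.ξ hX S.smooth_ξ S.smooth_ξ x
  have f : S.g.onVF S.ξ S.ξ = fun _ ↦ ε₀ := by
    funext y
    simp [PseudoRiemannianMetric.onVF, S.g_ξ, S.η_ξ]
  rw [f, mvfderiv_const] at m
  simp only [PseudoRiemannianMetric.onVF, nabla, S.g.symm x (S.ξ x), S.g_ξ] at m
  rcases S.ε₀_sign with h | h <;> simp [h] at m <;> linarith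

end AlmostParaContactMetric

/-! ### Noncommutative algebra of normal pairs. -/

section Ring
variable {R : Type*} [Ring R] {p q : R}

theorem mul_mul_eq_mul_of_idem (hqq : q * q = q) (a b : R) :
    q * a * q * b * q = q * a * q * (q * b * q) := by
  rw [show q * a * q * (q * b * q) = q * a * (q * q) * b * q by simp only [mul_assoc], hqq]

variable [Algebra ℝ R] {e : ℝ}

/-- Multiplying the relation for (c, c') by `p` on the left gives `h1`, which turns the remaining
factors into q(c' + cp). Multiplying by `q` on the left and `p` on the right gives q(c' + cp) =
qc'q, so only compressions survive. -/
theorem normal_pair_mul (he : e = 1 ∨ e = -1) (hpp : p * p = e • (1 - q)) (hpq : p * q = 0)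
    (hqp : q * p = 0) (hqq : q * q = q) {a a' c c' : R}
    (ha : a' * p - p * a' + e • a - p * a * p = e • (q * a * q))
    (hc : c' * p - p * c' + e • c - p * c * p = e • (q * c * q)) :
    e • (c * a) - p * (c * a) * p + (c * a') * p - p * (c * a') + (c' * a) * p - p * (c' * a)
        + c' * a' - e • (p * (c' * a') * p)
      = q * c' * q * a' * q + e • (q * c * q * a * q) := by
  have key {b b' : R} (hb : b' * p - p * b' + e • b - p * b * p = e • (q * b * q)) :
      q * (b' + b * p) = q * b' * q := by
    have h := congrArg (fun z ↦ q * z * p) hb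
    rcases he with rfl | rfl <;> simp only [one_smul, neg_smul] at h hpp ⊢
    · linear_combination (norm := noncomm_ring) h - q * b' * hpp + hqp * (b' * p + b * p * p)
        + q * q * b * hqp
    · linear_combination (norm := noncomm_ring) -h + q * b' * hpp - hqp * (b' * p + b * p * p)
        + q * q * b * hqp
  have ka := key ha
  have kc := key hc
  have kq := congrArg (· * q) hc
  have h1 : c * p - p * c + c' - e • (p * c' * p) = q * (c' + c * p) := by
    have h := congrArg (p * ·) hc
    rcases he with rfl | rfl <;> simp only [one_smul, neg_smul] at h hpp ⊢
    · linear_combination (norm := noncomm_ring) -h - hpp * (c' + c * p) - hpq * c * q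
    · linear_combination (norm := noncomm_ring) h + hpp * (c' + c * p) - hpq * c * q
  have h2 : q * (c' + c * p) * (a * p + a') = q * c' * q * a' * q := by
    linear_combination (norm := noncomm_ring) kc * (a * p + a') + q * c' * ka
  rcases he with rfl | rfl <;> simp only [one_smul, neg_smul] at *
  · linear_combination (norm := noncomm_ring) c * ha - p * c' * ha + h1 * (a * p + a') + h2
      + kq * (a * q) + q * c * hqq * a * q + (p * c - c') * hpq * (a * q)
  · linear_combination (norm := noncomm_ring) c * ha + p * c' * ha + h1 * (a * p + a') + h2
      + kq * (a * q) - q * c * hqq * a * q + (p * c - c') * hpq * (a * q)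

/-- This is the case a' = 0, met for derivatives along multiples of ξ. Multiplication by `q` and `p`
gives qkp = 0, and multiplication by `p` on the left then gives commutation. -/
theorem commute_of_normal_pair_zero (he : e = 1 ∨ e = -1) (hpp : p * p = e • (1 - q))
    (hpq : p * q = 0) (hqp : q * p = 0) {k : R}
    (hk : e • k - p * k * p = e • (q * k * q)) : k * p = p * k := by
  have h1 := congrArg (p * ·) hk
  have h2 := congrArg (q * · * p) hk
  rcases he with rfl | rfl <;> simp only [one_smul, neg_smul] at *
  · linear_combination (norm := noncomm_ring) -h1 - hpp * k * p + h2 + hqp * k * p * p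
      - hpq * k * q + q * q * k * hqp
  · linear_combination (norm := noncomm_ring) h1 + hpp * k * p - h2 - hqp * k * p * p
      - hpq * k * q + q * q * k * hqp

/-- Here `v`, `u`, `w`, `w'` stand for the covariant derivatives along `[Z, X]`, `[φZ, φX]`,
`V = [Z, φX] + [φZ, X]` and `φV`; `k` and `l` are covariant derivatives along multiples of `ξ`. -/
theorem normal_pair_bracket (he : e = 1 ∨ e = -1) (hpp : p * p = e • (1 - q))
    (hpq : p * q = 0) (hqp : q * p = 0) {v u w w' k l : R}
    (hv : v + e • u = e • w' + k)
    (hw : (e • (w - l)) * p - p * (e • (w - l)) + e • w' - p * w' * p = e • (q * w' * q))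
    (hk : e • k - p * k * p = e • (q * k * q)) (hl : e • l - p * l * p = e • (q * l * q)) :
    e • v - p * v * p + w * p - p * w + u - e • (p * u * p)
      = e • (q * v * q) + q * u * q := by
  have hlp := commute_of_normal_pair_zero he hpp hpq hqp hl
  obtain rfl : v = e • w' + k - e • u := eq_sub_of_add_eq hv
  rcases he with rfl | rfl <;> simp only [one_smul, neg_smul] at *
  · linear_combination (norm := noncomm_ring) hw + hk + hlp
  · linear_combination (norm := noncomm_ring) -hw + hk + hlp

/-- The elements ca - ac - v and its three analogues are the curvature operators. The product terms
are antisymmetrized and the bracket terms subtracted; `hqv` and `hqu` make the compressions cancel.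
-/
theorem normal_pair_curvature (he : e = 1 ∨ e = -1) (hpp : p * p = e • (1 - q))
    (hpq : p * q = 0) (hqp : q * p = 0) (hqq : q * q = q) {a a' c c' v u w₁ w₂ w' k l : R}
    (ha : a' * p - p * a' + e • a - p * a * p = e • (q * a * q))
    (hc : c' * p - p * c' + e • c - p * c * p = e • (q * c * q))
    (hv : v + e • u = e • w' + k)
    (hw : (e • (w₁ + w₂ - l)) * p - p * (e • (w₁ + w₂ - l)) + e • w' - p * w' * p
      = e • (q * w' * q))
    (hk : e • k - p * k * p = e • (q * k * q)) (hl : e • l - p * l * p = e • (q * l * q))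
    (hqv : q * v * q = q * c * q * a * q - q * a * q * c * q)
    (hqu : q * u * q = q * c' * q * a' * q - q * a' * q * c' * q) :
    e • (c * a - a * c - v) - p * (c * a - a * c - v) * p
      + (c * a' - a' * c - w₁) * p - p * (c * a' - a' * c - w₁)
      + (c' * a - a * c' - w₂) * p - p * (c' * a - a * c' - w₂)
      + (c' * a' - a' * c' - u) - e • (p * (c' * a' - a' * c' - u) * p) = 0 := by
  have h1 := normal_pair_mul he hpp hpq hqp hqq ha hc
  have h2 := normal_pair_mul he hpp hpq hqp hqq hc ha
  have h3 := normal_pair_bracket he hpp hpq hqp hv hw hk hl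
  rw [hqv, hqu] at h3
  rcases he with rfl | rfl <;> simp only [one_smul, neg_smul] at *
  · linear_combination (norm := noncomm_ring) h1 - h2 - h3
  · linear_combination (norm := noncomm_ring) h1 - h2 - h3

end Ring

/-! ### Covariant derivatives and curvature as operators. -/

theorem nabla_add {D : AffineConnection d M} (X : VField d M) {Y Z : VField d M}
    (hY : IsSmoothVF Y) (hZ : IsSmoothVF Z) :
    nabla D X (Y + Z) = nabla D X Y + nabla D X Z := by
  funext x
  simp only [nabla, Pi.add_apply, D.isCovariantDerivativeOnUniv.add (hY.mdifferentiableAt x)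
    (hZ.mdifferentiableAt x), add_apply]

theorem nabla_smul {D : AffineConnection d M} (X : VField d M) {f : M → ℝ}
    (hf : ContMDiff (𝓡 d) 𝓘(ℝ) ∞ f) {Y : VField d M} (hY : IsSmoothVF Y) :
    nabla D X (f • Y) = (fun x ↦ mvfderiv (𝓡 d) f x (X x)) • Y + f • nabla D X Y := by
  funext x
  have h := D.isCovariantDerivativeOnUniv.leibniz (hY.mdifferentiableAt x)
    (hf.mdifferentiableAt (x := x) (by simp))
  simp only [nabla, h, add_apply, smul_apply, Pi.add_apply, Pi.smul_apply',
    ContinuousLinearMap.smulRight_apply]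
  exact add_comm _ _

theorem nabla_const_smul {D : AffineConnection d M} (X : VField d M) (c : ℝ) {Y : VField d M}
    (hY : IsSmoothVF Y) : nabla D X (c • Y) = c • nabla D X Y := by
  funext x
  simp only [nabla, Pi.smul_apply,
    D.isCovariantDerivativeOnUniv.smul_const c (hY.mdifferentiableAt x), smul_apply]

/-- The operator `φ` on smooth vector fields. -/
def EndoField.toEnd (φ : EndoField d M) : Module.End ℝ (SmoothVF d M) where
  toFun Y := ⟨φ Y, φ.isSmoothVF Y.2⟩
  map_add' _ _ := Subtype.ext (funext fun _ ↦ map_add _ _ _)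
  map_smul' c Y := Subtype.ext (funext fun x ↦ by exact map_smul (φ.toFun x) c (Y.1 x))

theorem EndoField.toEnd_apply (φ : EndoField d M) (Y : SmoothVF d M) :
    (φ.toEnd Y : VField d M) = φ Y := rfl

/-- The operator `∇_X` on smooth vector fields. -/
def nablaEnd {D : AffineConnection d M} (hD : D.ContMDiffCovariantDerivative ∞) {X : VField d M}
    (hX : IsSmoothVF X) : Module.End ℝ (SmoothVF d M) where
  toFun Y := ⟨nabla D X Y, isSmoothVF_nabla hD hX Y.2⟩
  map_add' Y Z := Subtype.ext (nabla_add X Y.2 Z.2)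
  map_smul' c Y := Subtype.ext (nabla_const_smul X c Y.2)

theorem nablaEnd_apply {D : AffineConnection d M} (hD : D.ContMDiffCovariantDerivative ∞)
    {X : VField d M} (hX : IsSmoothVF X) (Y : SmoothVF d M) :
    (nablaEnd hD hX Y : VField d M) = nabla D X Y := rfl

theorem curvature_add {D : AffineConnection d M} (hD : D.ContMDiffCovariantDerivative ∞)
    {Z X Y Y' : VField d M} (hZ : IsSmoothVF Z) (hX : IsSmoothVF X) (hY : IsSmoothVF Y)
    (hY' : IsSmoothVF Y') :
    curvature D Z X (Y + Y') = curvature D Z X Y + curvature D Z X Y' := by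
  simp only [curvature]
  rw [nabla_add X hY hY', nabla_add Z hY hY', nabla_add _ hY hY',
    nabla_add Z (isSmoothVF_nabla hD hX hY) (isSmoothVF_nabla hD hX hY'),
    nabla_add X (isSmoothVF_nabla hD hZ hY) (isSmoothVF_nabla hD hZ hY')]
  abel

/-- Mixed first-order terms cancel, and the second derivatives of f cancel through the bracket
formula. The nowhere zero field U serves only that formula. -/
theorem curvature_smul {D : AffineConnection d M} (hD : D.ContMDiffCovariantDerivative ∞)
    {Z X Y U : VField d M} (hZ : IsSmoothVF Z) (hX : IsSmoothVF X) (hY : IsSmoothVF Y)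
    (hU : IsSmoothVF U) (hU0 : ∀ x, U x ≠ 0) {f : M → ℝ} (hf : ContMDiff (𝓡 d) 𝓘(ℝ) ∞ f) :
    curvature D Z X (f • Y) = f • curvature D Z X Y := by
  have hXf := contMDiff_mvfderiv hf hX
  have hZf := contMDiff_mvfderiv hf hZ
  have hXY := isSmoothVF_nabla hD hX hY
  have hZY := isSmoothVF_nabla hD hZ hY
  simp only [curvature]
  rw [nabla_smul X hf hY, nabla_smul Z hf hY, nabla_smul _ hf hY,
    nabla_add _ (hY.smul hXf) (hXY.smul hf), nabla_add _ (hY.smul hZf) (hZY.smul hf),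
    nabla_smul _ hXf hY, nabla_smul _ hf hXY, nabla_smul _ hZf hY, nabla_smul _ hf hZY]
  funext x
  simp only [Pi.sub_apply, Pi.add_apply, Pi.smul_apply', mvfderiv_mlieBracket hf hZ hX hU (hU0 x)]
  module

/-! ### The structure and the connection in the endomorphism ring. -/

namespace AlmostParaContactMetric
variable {ε₀ ε₁ : ℝ} (S : AlmostParaContactMetric d M ε₀ ε₁)

/-- The projection `Y ↦ η(Y) ξ` on smooth vector fields. -/
def projEnd : Module.End ℝ (SmoothVF d M) where
  toFun Y := ⟨S.η Y • S.ξ, S.smooth_ξ.smul (S.η.contMDiff Y.2)⟩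
  map_add' Y Z := Subtype.ext (funext fun x ↦ by
    simp [OneForm.onVF, add_smul])
  map_smul' c Y := Subtype.ext (funext fun x ↦ by
    simp [OneForm.onVF, smul_smul])

theorem projEnd_apply (Y : SmoothVF d M) : (S.projEnd Y : VField d M) = S.η Y • S.ξ := rfl

theorem toEnd_mul_self : S.φ.toEnd * S.φ.toEnd = ε₁ • (1 - S.projEnd) :=
  LinearMap.ext fun Y ↦ Subtype.ext (funext fun x ↦ by
    simpa [EndoField.toEnd_apply, projEnd_apply] using! S.φ_sq x (Y.1 x))

theorem toEnd_mul_projEnd : S.φ.toEnd * S.projEnd = 0 :=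
  LinearMap.ext fun Y ↦ Subtype.ext (funext fun x ↦ by
    simp [EndoField.toEnd_apply, projEnd_apply, EndoField.onVF, S.φ_ξ])

theorem projEnd_mul_toEnd : S.projEnd * S.φ.toEnd = 0 :=
  LinearMap.ext fun Y ↦ Subtype.ext (funext fun x ↦ by
    simp [EndoField.toEnd_apply, projEnd_apply, EndoField.onVF, OneForm.onVF, S.η_φ])

theorem projEnd_mul_self : S.projEnd * S.projEnd = S.projEnd :=
  LinearMap.ext fun Y ↦ Subtype.ext (funext fun x ↦ by
    simp [projEnd_apply, OneForm.onVF, S.η_ξ])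

variable {S} {D : AffineConnection d M}

theorem projEnd_nablaEnd_projEnd (hD : IsLeviCivita S.g D) {X : VField d M} (hX : IsSmoothVF X)
    (Y : SmoothVF d M) :
    ((S.projEnd * nablaEnd hD.smooth hX * S.projEnd) Y).1
      = (fun x ↦ mvfderiv (𝓡 d) (S.η Y) x (X x)) • S.ξ := by
  funext x
  change S.η.toFun x (nabla D X (S.η Y • S.ξ) x) • S.ξ x = _
  rw [nabla_smul X (S.η.contMDiff Y.2) S.smooth_ξ]
  simp only [Pi.add_apply, Pi.smul_apply', map_add, map_smul, S.η_ξ, nabla, η_nabla_ξ hD hX]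
  simp

/-- Compressions act by differentiating the coefficient of ξ, so this is the bracket formula for the
function η(Y), tested on ξ. -/
theorem projEnd_nablaEnd_mlieBracket (hD : IsLeviCivita S.g D) {Z X : VField d M}
    (hZ : IsSmoothVF Z) (hX : IsSmoothVF X) :
    S.projEnd * nablaEnd hD.smooth (isSmoothVF_mlieBracket hZ hX) * S.projEnd
      = S.projEnd * nablaEnd hD.smooth hZ * S.projEnd * nablaEnd hD.smooth hX * S.projEnd
        - S.projEnd * nablaEnd hD.smooth hX * S.projEnd * nablaEnd hD.smooth hZ * S.projEnd := by
  have two {A B : VField d M} (hA : IsSmoothVF A) (hB : IsSmoothVF B) (Y : SmoothVF d M) :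
      ((S.projEnd * nablaEnd hD.smooth hA * S.projEnd * nablaEnd hD.smooth hB * S.projEnd) Y).1
        = (fun x ↦ mvfderiv (𝓡 d) (fun y ↦ mvfderiv (𝓡 d) (S.η Y) y (B y)) x (A x)) • S.ξ := by
    rw [mul_mul_eq_mul_of_idem (R := Module.End ℝ (SmoothVF d M)) S.projEnd_mul_self, Module.End.mul_apply,
      projEnd_nablaEnd_projEnd hD]
    congr! 4
    rw [projEnd_nablaEnd_projEnd hD]
    funext x
    simp [OneForm.onVF, S.η_ξ]
  refine LinearMap.ext fun Y ↦ Subtype.ext ?_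
  rw [projEnd_nablaEnd_projEnd hD, LinearMap.sub_apply, Submodule.coe_sub, two, two]
  funext x
  simp only [Pi.sub_apply, Pi.smul_apply', ← sub_smul]
  rw [mvfderiv_mlieBracket (S.η.contMDiff Y.2) hZ hX S.smooth_ξ (S.ξ_ne_zero x)]

theorem nablaEnd_φ_relation [T2Space M] (hS : S.IsNormal) (hD : IsLeviCivita S.g D)
    {X : VField d M} (hX : IsSmoothVF X) :
    nablaEnd hD.smooth (S.φ.isSmoothVF hX) * S.φ.toEnd
        - S.φ.toEnd * nablaEnd hD.smooth (S.φ.isSmoothVF hX)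
        + ε₁ • nablaEnd hD.smooth hX - S.φ.toEnd * nablaEnd hD.smooth hX * S.φ.toEnd
      = ε₁ • (S.projEnd * nablaEnd hD.smooth hX * S.projEnd) := by
  refine LinearMap.ext fun Y ↦ Subtype.ext ?_
  rw [LinearMap.smul_apply, Submodule.coe_smul, projEnd_nablaEnd_projEnd hD]
  funext x
  have h := normalDefect_eq_zero hS hD hX Y.2 x
  simp only [LinearMap.add_apply, LinearMap.sub_apply, LinearMap.smul_apply, Module.End.mul_apply,
    Submodule.coe_add, Submodule.coe_sub, Submodule.coe_smul, EndoField.toEnd_apply, nablaEnd_apply]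
  change D (S.φ Y) x (S.φ X x) - S.φ.toFun x (D Y x (S.φ X x)) + ε₁ • D Y x (X x)
    - S.φ.toFun x (D (S.φ Y) x (X x)) = ε₁ • (mvfderiv (𝓡 d) (S.η Y) x (X x) • S.ξ x)
  rw [← sub_eq_zero, ← h, normalDefect]
  module

/-- Normality: `[Z, X] + ε₁ [φZ, φX] = ε₁ φ([Z, φX] + [φZ, X]) + (Z(η(X)) - X(η(Z))) ξ`. -/
theorem mlieBracket_add_of_isNormal (hS : S.IsNormal) {Z X : VField d M}
    (hZ : IsSmoothVF Z) (hX : IsSmoothVF X) (x : M) :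
    mlieBracket (𝓡 d) Z X x + ε₁ • mlieBracket (𝓡 d) (S.φ Z) (S.φ X) x
      = ε₁ • S.φ (mlieBracket (𝓡 d) Z (S.φ X) + mlieBracket (𝓡 d) (S.φ Z) X) x
        + (mvfderiv (𝓡 d) (S.η X) x (Z x) - mvfderiv (𝓡 d) (S.η Z) x (X x)) • S.ξ x := by
  have h := hS Z X hZ hX x
  simp only [nijenhuisOne, nijenhuis, Pi.sub_apply, Pi.add_apply, EndoField.onVF, S.φ_sq,
    OneForm.extDeriv] at h
  simp only [OneForm.onVF, EndoField.onVF, Pi.add_apply, map_add] at h ⊢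
  have e := S.ε₁_mul_self
  have h2 := congrArg (ε₁ • ·) h
  simp only [smul_zero] at h2
  rw [← sub_eq_zero]
  refine Eq.trans ?_ h2
  match_scalars
  · linear_combination -e
  · ring
  · ring
  · ring
  · linear_combination (mvfderiv (𝓡 d) (S.η X) x (Z x) - mvfderiv (𝓡 d) (S.η Z) x (X x)) * e

end AlmostParaContactMetric

/-! ### The curvature identities. -/

namespace AlmostParaContactMetric
variable {ε₀ ε₁ : ℝ} {S : AlmostParaContactMetric d M ε₀ ε₁} {D : AffineConnection d M}

/-- Since φ(fξ) = 0, the primed terms of the general relation drop out. -/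
theorem nablaEnd_smul_ξ_relation [T2Space M] (hS : S.IsNormal) (hD : IsLeviCivita S.g D)
    {f : M → ℝ} (hf : ContMDiff (𝓡 d) 𝓘(ℝ) ∞ f) :
    ε₁ • nablaEnd hD.smooth (S.smooth_ξ.smul hf)
        - S.φ.toEnd * nablaEnd hD.smooth (S.smooth_ξ.smul hf) * S.φ.toEnd
      = ε₁ • (S.projEnd * nablaEnd hD.smooth (S.smooth_ξ.smul hf) * S.projEnd) := by
  have h0 : nablaEnd hD.smooth (S.φ.isSmoothVF (S.smooth_ξ.smul hf)) = 0 := by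
    refine LinearMap.ext fun Y ↦ Subtype.ext (funext fun x ↦ ?_)
    simp [nablaEnd_apply, nabla, EndoField.onVF, S.φ_ξ]
  have h := nablaEnd_φ_relation hS hD (S.smooth_ξ.smul hf)
  rwa [h0, zero_mul, mul_zero, sub_zero (0 : Module.End ℝ (SmoothVF d M)), zero_add] at h

theorem curvature_identity [T2Space M] (hS : S.IsNormal) (hD : IsLeviCivita S.g D)
    {X Y Z : VField d M} (hX : IsSmoothVF X) (hY : IsSmoothVF Y) (hZ : IsSmoothVF Z) (x : M) :
    (ε₁ • curvature D Z X Y - S.φ (curvature D Z X (S.φ Y))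
      + curvature D Z (S.φ X) (S.φ Y) - S.φ (curvature D Z (S.φ X) Y)
      + curvature D (S.φ Z) X (S.φ Y) - S.φ (curvature D (S.φ Z) X Y)
      + curvature D (S.φ Z) (S.φ X) Y
      - ε₁ • S.φ (curvature D (S.φ Z) (S.φ X) (S.φ Y))) x = 0 := by
  have hφX := S.φ.isSmoothVF hX
  have hφZ := S.φ.isSmoothVF hZ
  have hv := isSmoothVF_mlieBracket hZ hX
  have hu := isSmoothVF_mlieBracket hφZ hφX
  have hw₁ := isSmoothVF_mlieBracket hZ hφX
  have hw₂ := isSmoothVF_mlieBracket hφZ hX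
  have hV : IsSmoothVF (mlieBracket (𝓡 d) Z (S.φ X) + mlieBracket (𝓡 d) (S.φ Z) X) :=
    (SmoothVF d M).add_mem hw₁ hw₂
  have hf := (contMDiff_mvfderiv (S.η.contMDiff hX) hZ).sub
    (contMDiff_mvfderiv (S.η.contMDiff hZ) hX)
  have hvu : nablaEnd hD.smooth hv + ε₁ • nablaEnd hD.smooth hu
      = ε₁ • nablaEnd hD.smooth (S.φ.isSmoothVF hV) + nablaEnd hD.smooth (S.smooth_ξ.smul hf) := by
    refine LinearMap.ext fun Y ↦ Subtype.ext (funext fun x ↦ ?_)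
    have h := congrArg (D Y.1 x) (mlieBracket_add_of_isNormal hS hZ hX x)
    rw [map_add, map_add, map_smul, map_smul] at h
    exact h
  have hφφ : nablaEnd hD.smooth (S.φ.isSmoothVF (S.φ.isSmoothVF hV))
      = ε₁ • (nablaEnd hD.smooth hw₁ + nablaEnd hD.smooth hw₂
        - nablaEnd hD.smooth (S.smooth_ξ.smul (S.η.contMDiff hV))) := by
    refine LinearMap.ext fun Y ↦ Subtype.ext (funext fun x ↦ ?_)
    have h := congrArg (D Y.1 x) (S.φ_sq x
      ((mlieBracket (𝓡 d) Z (S.φ X) + mlieBracket (𝓡 d) (S.φ Z) X) x))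
    refine Eq.trans h ?_
    rw [map_smul, map_sub, Pi.add_apply, map_add]
    rfl
  -- The relation is taken along φV, with V = [Z, φX] + [φZ, X], because normality expresses the
  -- brackets through φV; its primed term is then a derivative along φ²V, computed in `hφφ`.
  have hw := nablaEnd_φ_relation hS hD (S.φ.isSmoothVF hV)
  rw [hφφ] at hw
  have key := normal_pair_curvature (R := Module.End ℝ (SmoothVF d M)) S.ε₁_sign S.toEnd_mul_self
    S.toEnd_mul_projEnd S.projEnd_mul_toEnd S.projEnd_mul_self (nablaEnd_φ_relation hS hD hX)
    (nablaEnd_φ_relation hS hD hZ) hvu hw (nablaEnd_smul_ξ_relation hS hD hf)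
    (nablaEnd_smul_ξ_relation hS hD (S.η.contMDiff hV)) (projEnd_nablaEnd_mlieBracket hD hZ hX)
    (projEnd_nablaEnd_mlieBracket hD hφZ hφX)
  have h := congrFun (congrArg Subtype.val (LinearMap.congr_fun key ⟨Y, hY⟩)) x
  simp only [LinearMap.add_apply, LinearMap.sub_apply, LinearMap.smul_apply, Module.End.mul_apply,
    Submodule.coe_add, Submodule.coe_sub, Submodule.coe_smul, EndoField.toEnd_apply,
    nablaEnd_apply] at h
  exact h

theorem curvature_opCommutator_identity [T2Space M] (hS : S.IsNormal) (hD : IsLeviCivita S.g D)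
    {X Y Z : VField d M} (hX : IsSmoothVF X) (hY : IsSmoothVF Y) (hZ : IsSmoothVF Z) (x : M) :
    (opCommutator (curvature D Z (S.φ X)) S.φ Y
        + opCommutator (curvature D (S.φ Z) X) S.φ Y
        + ε₁ • opCommutator (curvature D (S.φ Z) (S.φ X)) S.φ (S.φ Y)
        + opCommutator (curvature D Z X) S.φ (S.φ Y)) x
      = -(S.η Y x) • (ε₁ • curvature D Z X S.ξ + curvature D (S.φ Z) (S.φ X) S.ξ) x := by
  have hφX := S.φ.isSmoothVF hX
  have hφZ := S.φ.isSmoothVF hZ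
  have h2 := curvature_identity hS hD hX hY hZ x
  have sq {A B : VField d M} (hA : IsSmoothVF A) (hB : IsSmoothVF B) :
      curvature D A B (S.φ (S.φ Y)) x
        = ε₁ • (curvature D A B Y x - S.η Y x • curvature D A B S.ξ x) := by
    have hηY : ContMDiff (𝓡 d) 𝓘(ℝ) ∞ (-S.η Y) := (S.η.contMDiff hY).neg
    have hsum : IsSmoothVF (Y + (-S.η Y) • S.ξ) :=
      (SmoothVF d M).add_mem hY (S.smooth_ξ.smul hηY)
    -- The sign is written as a constant function so that `curvature_smul` also pulls it out.
    have h : S.φ (S.φ Y) = (fun _ : M ↦ ε₁) • (Y + (-S.η Y) • S.ξ) := by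
      funext y
      refine (S.φ_sq y (Y y)).trans ?_
      simp [sub_eq_add_neg, OneForm.onVF]
    rw [h, curvature_smul hD.smooth hA hB hsum S.smooth_ξ S.ξ_ne_zero contMDiff_const,
      curvature_add hD.smooth hA hB hY (S.smooth_ξ.smul hηY),
      curvature_smul hD.smooth hA hB S.smooth_ξ S.smooth_ξ S.ξ_ne_zero hηY]
    simp [sub_eq_add_neg]
  simp only [opCommutator, Pi.add_apply, Pi.sub_apply, Pi.smul_apply] at h2 ⊢
  rw [sq hZ hX, sq hφZ hφX]
  refine sub_eq_zero.1 (Eq.trans ?_ h2)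
  have e := S.ε₁_mul_self
  match_scalars
  all_goals first | ring1 | linear_combination e | linear_combination -(S.η Y x) * e

end AlmostParaContactMetric
end ParaContact
end

theorem mainTheorem4 {n : ℕ} {M : Type*} [TopologicalSpace M] [T2Space M]
    [ChartedSpace (EuclideanSpace ℝ (Fin (2 * n + 1))) M] [IsManifold (𝓡 (2 * n + 1)) ∞ M]
    {ε₀ ε₁ : ℝ} (S : ParaContact.AlmostParaContactMetric (2 * n + 1) M ε₀ ε₁)
    (hS : S.IsNormal)
    (D : ParaContact.AffineConnection (2 * n + 1) M) (hD : ParaContact.IsLeviCivita S.g D)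
    (X Y Z : ParaContact.VField (2 * n + 1) M)
    (hX : ParaContact.IsSmoothVF X) (hY : ParaContact.IsSmoothVF Y)
    (hZ : ParaContact.IsSmoothVF Z) :
    (∀ x : M,
      (ParaContact.opCommutator (ParaContact.curvature D Z (S.φ X)) S.φ Y
        + ParaContact.opCommutator (ParaContact.curvature D (S.φ Z) X) S.φ Y
        + ε₁ • ParaContact.opCommutator (ParaContact.curvature D (S.φ Z) (S.φ X)) S.φ (S.φ Y)
        + ParaContact.opCommutator (ParaContact.curvature D Z X) S.φ (S.φ Y)) x
      = -(S.η Y x) • (ε₁ • ParaContact.curvature D Z X S.ξ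
          + ParaContact.curvature D (S.φ Z) (S.φ X) S.ξ) x) ∧
    (∀ x : M,
      (ε₁ • ParaContact.curvature D Z X Y - S.φ (ParaContact.curvature D Z X (S.φ Y))
        + ParaContact.curvature D Z (S.φ X) (S.φ Y) - S.φ (ParaContact.curvature D Z (S.φ X) Y)
        + ParaContact.curvature D (S.φ Z) X (S.φ Y) - S.φ (ParaContact.curvature D (S.φ Z) X Y)
        + ParaContact.curvature D (S.φ Z) (S.φ X) Y
        - ε₁ • S.φ (ParaContact.curvature D (S.φ Z) (S.φ X) (S.φ Y))) x = 0) := by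
  exact ⟨ParaContact.AlmostParaContactMetric.curvature_opCommutator_identity hS hD hX hY hZ,
    ParaContact.AlmostParaContactMetric.curvature_identity hS hD hX hY hZ⟩
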